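/- Let $F$ be a field of characteristic not $2$, let $V$ be an $F$-vector space (of any dimension) with a symmetric bilinear form $B$, and let $\mathrm{Cl}(V)$ be its Clifford algebra, the quotient of the tensor algebra by the relations $uv+vu=2B(u,v)$. Let $\mathrm{Cl}^k(V)$ denote the preimage of the $k$-th exterior power of $V$ under the canonical linear isomorphism from $\mathrm{Cl}(V)$ to the exterior algebra of $V$, and let $x\times y=\tfrac12(xy-yx)$. The space of bivectors $\mathrm{Cl}^2(V)$ is a Lie algebra under $\times$. Let $e_0\in V$ be a nonzero vector with $B(e_0,v)=0$ for all $v\in V$, and let $W\subseteq V$ be a linear complement of $Fe_0$. Equip $W$ with the restriction of $B$ and $V/Fe_0$ with the form induced by $B$. For any such quadratic space $U$ (here $U=W$ or $U=V/Fe_0$), regard $U$ as an abelian Lie algebra and let $\mathrm{Cl}^2(U)\ltimes_\tau U$ be the semidirect sum for the Lie algebra homomorphism $\tau:\mathrm{Cl}^2(U)\to\mathrm{Der}(U)$, $\tau(b)(u)=b\times u$ (the commutator being taken in $\mathrm{Cl}(U)$, where it lies in $U$). Theorem. 1. The homomorphism $\mathrm{Cl}^2(W)\to\mathrm{Cl}^2(V)$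 induced by the inclusion is injective, $We_0=\{we_0 : w\in W\}$ is an abelian ideal of the Lie algebra $\mathrm{Cl}^2(V)$, and $\mathrm{Cl}^2(V)=\mathrm{Cl}^2(W)\oplus We_0$ as vector spaces. That is, $\mathrm{Cl}^2(V)$ is the internal semidirect sum $\mathrm{Cl}^2(W)\ltimes We_0$. 2. There is an isomorphism of Lie algebras $\mathrm{Cl}^2(V)\cong\mathrm{Cl}^2(W)\ltimes_\tau W$ sending $b\mapsto(b,0)$ for $b\in\mathrm{Cl}^2(W)$ and $we_0\mapsto(0,w)$ for $w\in W$. 3. There is an isomorphism of Lie algebras $\mathrm{Cl}^2(V)\cong\mathrm{Cl}^2(V/Fe_0)\ltimes_{\tau'}V/Fe_0$, where $\tau'$ is the map $\tau$ for $U=V/Fe_0$, sending $b\mapsto(\mathrm{Cl}^2(\pi)(b),0)$ for $b\in\mathrm{Cl}^2(W)$ and $we_0\mapsto(0,\pi(w))$ for $w\in W$, where $\pi:V\to V/Fe_0$ is the canonical projection and $\mathrm{Cl}^2(\pi)$ the homomorphism it induces. -/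

import Mathlib

noncomputable section

namespace PGA

open CliffordAlgebra

section Grade

variable {F : Type*} [Field F] [Invertible (2 : F)] {V : Type*} [AddCommGroup V] [Module F V]

/-- The grade-`k` part `Cl^k` of the Clifford algebra: the preimage of the `k`-th exterior power
under the canonical linear isomorphism from the Clifford algebra to the exterior algebra. -/
def grade (Q : QuadraticForm F V) (k : ℕ) : Submodule F (CliffordAlgebra Q) :=
  (⋀[F]^k V).comap (equivExterior Q : CliffordAlgebra Q →ₗ[F] ExteriorAlgebra F V)

/-- The commutator product `x × y = (1/2) (x y - y x)`. -/
def comm {A : Type*} [Ring A] [Algebra F A] (x y : A) : A := (⅟2 : F) • (x * y - y * x)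

variable (Q : QuadraticForm F V)

lemma equivExterior_ι (v : V) : equivExterior Q (ι Q v) = ExteriorAlgebra.ι F v :=
  changeForm_ι (changeForm.associated_neg_proof (Q := Q)) v

lemma equivExterior_symm_ι (v : V) : (equivExterior Q).symm (ExteriorAlgebra.ι F v) = ι Q v := by
  rw [LinearEquiv.symm_apply_eq, equivExterior_ι]

lemma equivExterior_comm (u v : V) :
    equivExterior Q (comm (F := F) (ι Q u) (ι Q v)) =
      ExteriorAlgebra.ι F u * ExteriorAlgebra.ι F v := by
  have h : ∀ a b : V, equivExterior Q (ι Q a * ι Q b) =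
      ExteriorAlgebra.ι F a * ExteriorAlgebra.ι F b -
        algebraMap F _ ((QuadraticMap.associated (R := F) (M := V) (-Q)) a b) :=
    fun a b => changeForm_ι_mul_ι (changeForm.associated_neg_proof (Q := Q)) a b
  have hs : (QuadraticMap.associated (R := F) (M := V) (-Q)) v u =
      (QuadraticMap.associated (R := F) (M := V) (-Q)) u v :=
    QuadraticMap.associated_isSymm F (-Q) v u
  have hanti : ExteriorAlgebra.ι F v * ExteriorAlgebra.ι F u =
      -(ExteriorAlgebra.ι F u * ExteriorAlgebra.ι F v) :=
    eq_neg_of_add_eq_zero_right (ExteriorAlgebra.ι_add_mul_swap u v)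
  rw [comm, map_smul, map_sub, h, h, hs, hanti, sub_sub_sub_cancel_right, sub_neg_eq_add,
    ← two_smul F, smul_smul, invOf_mul_self, one_smul]

/-- Bivectors are the linear span of the elements `u × v` for vectors `u`, `v`. -/
lemma grade_two_eq_span :
    grade Q 2 = Submodule.span F {x | ∃ u v : V, x = comm (F := F) (ι Q u) (ι Q v)} := by
  have h : grade Q 2 = (⋀[F]^2 V).map ((equivExterior Q).symm :
      ExteriorAlgebra F V →ₗ[F] CliffordAlgebra Q) := by
    rw [grade]
    exact (Submodule.map_equiv_eq_comap_symm (equivExterior Q).symm _).symm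
  rw [h, ← ExteriorAlgebra.ιMulti_span_fixedDegree, Submodule.map_span]
  congr 1
  ext x
  constructor
  · rintro ⟨_, ⟨a, rfl⟩, rfl⟩
    refine ⟨a 0, a 1, ?_⟩
    rw [LinearEquiv.coe_coe, LinearEquiv.symm_apply_eq, equivExterior_comm]
    simp [ExteriorAlgebra.ιMulti_apply, Matrix.vecTail]
  · rintro ⟨u, v, rfl⟩
    refine ⟨_, ⟨![u, v], rfl⟩, ?_⟩
    rw [LinearEquiv.coe_coe, LinearEquiv.symm_apply_eq, equivExterior_comm]
    simp [ExteriorAlgebra.ιMulti_apply]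

lemma comm_ι_mem (u v : V) : comm (F := F) (ι Q u) (ι Q v) ∈ grade Q 2 := by
  rw [grade_two_eq_span]
  exact Submodule.subset_span ⟨u, v, rfl⟩

/-- `x × y` as a bilinear map. -/
def commL (A : Type*) [Ring A] [Algebra F A] : A →ₗ[F] A →ₗ[F] A :=
  LinearMap.mk₂ F (comm (F := F))
    (fun x y z => by simp only [comm, ← smul_add]; congr 1; noncomm_ring)
    (fun c x y => by
      simp only [comm, smul_mul_assoc, mul_smul_comm, ← smul_sub]; rw [smul_comm])
    (fun x y z => by simp only [comm, ← smul_add]; congr 1; noncomm_ring)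
    (fun c x y => by
      simp only [comm, smul_mul_assoc, mul_smul_comm, ← smul_sub]; rw [smul_comm])

lemma commL_apply {A : Type*} [Ring A] [Algebra F A] (x y : A) :
    commL (F := F) A x y = comm (F := F) x y := rfl

lemma comm_self {A : Type*} [Ring A] [Algebra F A] (x : A) : comm (F := F) x x = 0 := by
  simp [comm]

lemma comm_leibniz {A : Type*} [Ring A] [Algebra F A] (x y z : A) :
    comm (F := F) x (comm (F := F) y z) =
      comm (F := F) (comm (F := F) x y) z + comm (F := F) y (comm (F := F) x z) := by
  simp only [comm, mul_smul_comm, smul_mul_assoc, ← smul_sub, ← smul_add]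
  congr 2
  noncomm_ring

lemma comm_comm_ι (u v w : V) :
    comm (F := F) (comm (F := F) (ι Q u) (ι Q v)) (ι Q w) =
      ι Q ((⅟2 * QuadraticMap.polar Q v w) • u - (⅟2 * QuadraticMap.polar Q u w) • v) := by
  have key : ∀ a b c : V, ι Q a * ι Q b * ι Q c - ι Q c * (ι Q a * ι Q b) =
      QuadraticMap.polar Q b c • ι Q a - QuadraticMap.polar Q a c • ι Q b := by
    intro a b c
    have h1 := ι_mul_ι_add_swap (Q := Q) b c
    have h2 := ι_mul_ι_add_swap (Q := Q) a c
    have e : ι Q a * ι Q b * ι Q c - ι Q c * (ι Q a * ι Q b) =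
        ι Q a * (ι Q b * ι Q c + ι Q c * ι Q b) - (ι Q a * ι Q c + ι Q c * ι Q a) * ι Q b := by
      noncomm_ring
    rw [e, h1, h2, ← Algebra.commutes, ← Algebra.smul_def, ← Algebra.smul_def]
  have e : comm (F := F) (comm (F := F) (ι Q u) (ι Q v)) (ι Q w) =
      (⅟2 : F) • (⅟2 : F) • ((ι Q u * ι Q v * ι Q w - ι Q w * (ι Q u * ι Q v)) -
        (ι Q v * ι Q u * ι Q w - ι Q w * (ι Q v * ι Q u))) := by
    simp only [comm, mul_smul_comm, smul_mul_assoc, ← smul_sub]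
    congr 2
    noncomm_ring
  have e2 : ∀ p q : CliffordAlgebra Q, p - q - (q - p) = (2 : F) • (p - q) := by
    intro p q
    rw [two_smul]
    abel
  rw [e, key, key, e2, smul_smul (⅟2 : F) (2 : F), invOf_mul_self, one_smul, smul_sub, smul_smul,
    smul_smul, map_sub, map_smul, map_smul]

/-- For a bivector `b` and a vector `w`, the commutator `b × w` is a vector. -/
lemma comm_ι_mem_range {b : CliffordAlgebra Q} (hb : b ∈ grade Q 2) (w : V) :
    comm (F := F) b (ι Q w) ∈ LinearMap.range (ι Q) := by
  rw [grade_two_eq_span] at hb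
  induction hb using Submodule.span_induction with
  | mem x hx =>
    obtain ⟨u, v, rfl⟩ := hx
    rw [comm_comm_ι]
    exact ⟨_, rfl⟩
  | zero => rw [← commL_apply, map_zero]; exact zero_mem _
  | add x y _ _ hx hy =>
    rw [← commL_apply, map_add]; exact add_mem hx hy
  | smul c x _ hx =>
    rw [← commL_apply, map_smul]; exact Submodule.smul_mem _ c hx

lemma comm_mem {x y : CliffordAlgebra Q} (hx : x ∈ grade Q 2) (hy : y ∈ grade Q 2) :
    comm (F := F) x y ∈ grade Q 2 := by
  rw [grade_two_eq_span] at hy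
  induction hy using Submodule.span_induction with
  | mem y hy =>
    obtain ⟨u, v, rfl⟩ := hy
    obtain ⟨u', hu⟩ := comm_ι_mem_range Q hx u
    obtain ⟨v', hv⟩ := comm_ι_mem_range Q hx v
    rw [comm_leibniz, ← hu, ← hv]
    exact add_mem (comm_ι_mem Q _ _) (comm_ι_mem Q _ _)
  | zero => rw [← commL_apply, map_zero]; exact zero_mem _
  | add y z _ _ h1 h2 => rw [← commL_apply, map_add]; exact add_mem h1 h2
  | smul c y _ h => rw [← commL_apply, map_smul]; exact Submodule.smul_mem _ c h

/-- The space of bivectors. -/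
abbrev Bivector : Type _ := grade Q 2

/-- Bivectors form a Lie algebra under the commutator product. -/
instance : Bracket (Bivector Q) (Bivector Q) where
  bracket x y := ⟨comm (F := F) x.1 y.1, comm_mem Q x.2 y.2⟩

lemma coe_lie (x y : Bivector Q) :
    (⁅x, y⁆ : Bivector Q).1 = comm (F := F) x.1 y.1 := rfl

instance : LieRing (Bivector Q) where
  add_lie x y z := Subtype.ext (LinearMap.map_add₂ (commL (F := F) _) x.1 y.1 z.1)
  lie_add x y z := Subtype.ext (map_add (commL (F := F) _ x.1) y.1 z.1)
  lie_self x := Subtype.ext (comm_self x.1)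
  leibniz_lie x y z := Subtype.ext (comm_leibniz x.1 y.1 z.1)

instance : LieAlgebra F (Bivector Q) where
  lie_smul c x y := Subtype.ext (map_smul (commL (F := F) _ x.1) c y.1)

end Grade

section Abelian

/-- A vector space regarded as an abelian Lie algebra (all brackets are zero). -/
def AbelianLie (M : Type*) : Type _ := M

variable {F : Type*} [Field F] {M : Type*} [AddCommGroup M] [Module F M]

instance : AddCommGroup (AbelianLie M) := inferInstanceAs (AddCommGroup M)

instance : Module F (AbelianLie M) := inferInstanceAs (Module F M)

instance : LieRing (AbelianLie M) where
  bracket _ _ := 0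
  add_lie _ _ _ := (add_zero _).symm
  lie_add _ _ _ := (add_zero _).symm
  lie_self _ := rfl
  leibniz_lie _ _ _ := (add_zero _).symm

instance : LieAlgebra F (AbelianLie M) where
  lie_smul c _ _ := (smul_zero c).symm

/-- A vector as an element of the abelian Lie algebra. -/
def AbelianLie.of (F : Type*) [Field F] {M : Type*} [AddCommGroup M] [Module F M] :
    M ≃ₗ[F] AbelianLie M := LinearEquiv.refl F M

lemma AbelianLie.lie_eq_zero (x y : AbelianLie M) : ⁅x, y⁆ = 0 := rfl

end Abelian

section Action

variable {F : Type*} [Field F] [Invertible (2 : F)] {V : Type*} [AddCommGroup V] [Module F V]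
variable (Q : QuadraticForm F V)

/-- The left inverse of `ι : V → Cl(V)` that reads off the grade-one part. -/
def vectorPart : CliffordAlgebra Q →ₗ[F] V :=
  ExteriorAlgebra.ιInv ∘ₗ (equivExterior Q : CliffordAlgebra Q →ₗ[F] ExteriorAlgebra F V)

lemma vectorPart_ι (v : V) : vectorPart Q (ι Q v) = v := by
  simp only [vectorPart, LinearMap.comp_apply, LinearEquiv.coe_coe, equivExterior_ι]
  exact ExteriorAlgebra.ι_leftInverse v

/-- `b × w` as a vector. -/
def actVec (b : Bivector Q) : V →ₗ[F] V :=
  vectorPart Q ∘ₗ commL (F := F) _ b.1 ∘ₗ ι Q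

/-- The vector `actVec Q b w` is indeed the commutator `b × w`. -/
lemma ι_actVec (b : Bivector Q) (w : V) :
    ι Q (actVec Q b w) = comm (F := F) b.1 (ι Q w) := by
  obtain ⟨u, hu⟩ := comm_ι_mem_range Q b.2 w
  simp only [actVec, LinearMap.comp_apply, commL_apply]
  rw [← hu, vectorPart_ι]

lemma actVec_lie (b c : Bivector Q) (w : V) :
    actVec Q ⁅b, c⁆ w = actVec Q b (actVec Q c w) - actVec Q c (actVec Q b w) := by
  have inj : Function.Injective (ι Q) := Function.LeftInverse.injective (vectorPart_ι Q)
  apply inj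
  rw [map_sub, ι_actVec, ι_actVec, ι_actVec, ι_actVec, ι_actVec, coe_lie]
  exact eq_sub_of_add_eq (comm_leibniz b.1 c.1 (ι Q w)).symm

/-- The action `τ(b) : w ↦ b × w` of bivectors by derivations of the abelian Lie algebra
of vectors. -/
def tau : Bivector Q →ₗ⁅F⁆ LieDerivation F (AbelianLie V) (AbelianLie V) where
  toFun b :=
    { toLinearMap := (AbelianLie.of F).conj (actVec Q b)
      leibniz' := fun x y => by simp only [AbelianLie.lie_eq_zero, map_zero, sub_zero] }
  map_add' b c := by
    ext w
    change vectorPart Q (commL (F := F) _ (b.1 + c.1) (ι Q w)) =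
      vectorPart Q (commL (F := F) _ b.1 (ι Q w)) + vectorPart Q (commL (F := F) _ c.1 (ι Q w))
    rw [LinearMap.map_add₂, map_add]
  map_smul' r b := by
    ext w
    change vectorPart Q (commL (F := F) _ (r • b.1) (ι Q w)) =
      r • vectorPart Q (commL (F := F) _ b.1 (ι Q w))
    rw [LinearMap.map_smul₂, map_smul]
  map_lie' := by
    intro b c
    ext w
    rw [LieDerivation.lie_apply]
    exact actVec_lie Q b c w

lemma tau_apply (b : Bivector Q) (w : V) :
    tau Q b (AbelianLie.of F w) = AbelianLie.of F (actVec Q b w) := rfl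

end Action

section Functor

variable {F : Type*} [Field F] [Invertible (2 : F)]
variable {V₁ : Type*} [AddCommGroup V₁] [Module F V₁] {V₂ : Type*} [AddCommGroup V₂] [Module F V₂]
variable {Q₁ : QuadraticForm F V₁} {Q₂ : QuadraticForm F V₂}

lemma map_comm {A C : Type*} [Ring A] [Algebra F A] [Ring C] [Algebra F C] (f : A →ₐ[F] C)
    (x y : A) : f (comm (F := F) x y) = comm (F := F) (f x) (f y) := by
  simp [comm]

lemma map_mem_grade_two (f : Q₁ →qᵢ Q₂) {x : CliffordAlgebra Q₁} (hx : x ∈ grade Q₁ 2) :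
    CliffordAlgebra.map f x ∈ grade Q₂ 2 := by
  rw [grade_two_eq_span] at hx
  induction hx using Submodule.span_induction with
  | mem x hx =>
    obtain ⟨u, v, rfl⟩ := hx
    rw [map_comm, map_apply_ι, map_apply_ι]
    exact comm_ι_mem Q₂ _ _
  | zero => rw [map_zero]; exact zero_mem _
  | add x y _ _ hx hy => rw [map_add]; exact add_mem hx hy
  | smul c x _ hx => rw [map_smul]; exact Submodule.smul_mem _ c hx

/-- The Lie algebra homomorphism `Cl²(f) : Cl²(V₁) → Cl²(V₂)` that the Clifford extension of an
isometry `f` restricts to. -/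
def bivectorMap (f : Q₁ →qᵢ Q₂) : Bivector Q₁ →ₗ⁅F⁆ Bivector Q₂ where
  toFun x := ⟨CliffordAlgebra.map f x.1, map_mem_grade_two f x.2⟩
  map_add' x y := Subtype.ext (map_add _ x.1 y.1)
  map_smul' c x := Subtype.ext (map_smul _ c x.1)
  map_lie' := Subtype.ext (map_comm _ _ _)

end Functor

section Spaces

variable {F : Type*} [Field F] {V : Type*} [AddCommGroup V] [Module F V]

/-- The quadratic form `v ↦ B(v, v)`; its Clifford algebra is the quotient of the tensor algebra
by the relations `u v + v u = 2 B(u, v)` when `B` is symmetric and `2` is invertible. -/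
abbrev quad (B : LinearMap.BilinForm F V) : QuadraticForm F V := B.toQuadraticMap

/-- The isometric inclusion of a subspace. -/
def inclusion (B : LinearMap.BilinForm F V) (W : Submodule F V) :
    quad (B.restrict W) →qᵢ quad B where
  toLinearMap := W.subtype
  map_app' _ := rfl

/-- The bilinear form induced on the quotient by a radical subspace. -/
def quotientForm (B : LinearMap.BilinForm F V) (hB : B.IsSymm) (U : Submodule F V)
    (hU : U ≤ LinearMap.ker B) : LinearMap.BilinForm F (V ⧸ U) :=
  hB.isRefl.liftQ₂ B U hU

lemma quotientForm_mk (B : LinearMap.BilinForm F V) (hB : B.IsSymm) (U : Submodule F V)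
    (hU : U ≤ LinearMap.ker B) (u v : V) :
    quotientForm B hB U hU (U.mkQ u) (U.mkQ v) = B u v := rfl

/-- The canonical projection onto the quotient by a radical subspace, an isometry. -/
def projection (B : LinearMap.BilinForm F V) (hB : B.IsSymm) (U : Submodule F V)
    (hU : U ≤ LinearMap.ker B) : quad B →qᵢ quad (quotientForm B hB U hU) where
  toLinearMap := U.mkQ
  map_app' _ := rfl

end Spaces

end PGA

end

/-!
The projection `r : V → V/Fe₀` is an isometry, because `e₀` is in the radical, and `W` provides an
isometric section `s`. Hence `Cl²(r)` is a split surjection of Lie algebras. Writing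
`v = s(r v) + c e₀` in `v × w` shows that its kernel consists of the products `u e₀ = u × e₀`.
Since bivectors commute with `e₀`, the Leibniz rule gives `b × (u e₀) = (b × u) e₀`: the kernel is
abelian and `Cl²` acts on it through `τ`.
-/

noncomputable section

namespace PGA

open CliffordAlgebra LieAlgebra

section SplitExtension

variable {R : Type*} [CommRing R] {K : Type*} [LieRing K] [LieAlgebra R K]
variable {L : Type*} [LieRing L] [LieAlgebra R L] {M : Type*} [LieRing M] [LieAlgebra R M]
variable {f : K →ₗ⁅R⁆ M} {g : M →ₗ⁅R⁆ L} {σ : L →ₗ⁅R⁆ M} {ψ : L →ₗ⁅R⁆ LieDerivation R K K}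

lemma isLieAbelian_ker_of_exact [IsLieAbelian K] (hfg : Function.Exact f g) :
    IsLieAbelian g.ker where
  trivial := by
    rintro ⟨x, hx⟩ ⟨y, hy⟩
    obtain ⟨k, rfl⟩ := (hfg x).mp (LieHom.mem_ker.mp hx)
    obtain ⟨l, rfl⟩ := (hfg y).mp (LieHom.mem_ker.mp hy)
    apply Subtype.ext
    change ⁅f k, f l⁆ = 0
    rw [← LieHom.map_lie, trivial_lie_zero, map_zero]

lemma isCompl_range_ker_of_leftInverse (hσ : Function.LeftInverse g σ) :
    IsCompl σ.range.toSubmodule g.ker.toSubmodule := by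
  refine ⟨Submodule.disjoint_def.mpr ?_, codisjoint_iff.mpr (eq_top_iff.mpr fun x _ => ?_)⟩
  · rintro _ ⟨l, rfl⟩ hl
    change g (σ l) = 0 at hl
    change σ l = 0
    rw [← hσ l, hl, map_zero]
  · rw [← add_sub_cancel (σ (g x)) x]
    refine Submodule.add_mem_sup ⟨g x, rfl⟩ (LieHom.mem_ker.mpr ?_)
    rw [map_sub, hσ, sub_self]

/-- The Lie algebra homomorphism `(k, l) ↦ f k + σ l` out of a semidirect sum. -/
def semiDirectSumLift (f : K →ₗ⁅R⁆ M) (σ : L →ₗ⁅R⁆ M) (hact : ∀ l k, ⁅σ l, f k⁆ = f (ψ l k)) :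
    (K ⋊⁅ψ⁆ L) →ₗ⁅R⁆ M where
  toFun x := f x.left + σ x.right
  map_add' x y := by
    simp only [SemiDirectSum.add_eq_mk, map_add]
    abel
  map_smul' c x := by
    simp only [SemiDirectSum.smul_eq_mk, map_smul, smul_add, RingHom.id_apply]
  map_lie' := by
    intro x y
    simp only [SemiDirectSum.lie_eq_mk, map_add, map_sub, LieHom.map_lie, add_lie, lie_add,
      ← hact, ← lie_skew (f x.left) (σ y.right)]
    abel

lemma semiDirectSumLift_inl (hact : ∀ l k, ⁅σ l, f k⁆ = f (ψ l k)) (k : K) :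
    semiDirectSumLift f σ hact (SemiDirectSum.inl ψ k) = f k := by
  change f k + σ 0 = f k
  rw [map_zero, add_zero]

lemma semiDirectSumLift_inr (hact : ∀ l k, ⁅σ l, f k⁆ = f (ψ l k)) (l : L) :
    semiDirectSumLift f σ hact (SemiDirectSum.inr ψ l) = σ l := by
  change f 0 + σ l = σ l
  rw [map_zero, zero_add]

lemma semiDirectSumLift_bijective (hf : Function.Injective f) (hfg : Function.Exact f g)
    (hσ : Function.LeftInverse g σ) (hact : ∀ l k, ⁅σ l, f k⁆ = f (ψ l k)) :
    Function.Bijective (semiDirectSumLift f σ hact) := by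
  refine ⟨(injective_iff_map_eq_zero _).mpr ?_, fun x => ?_⟩
  · rintro ⟨k, l⟩ (hx : f k + σ l = 0)
    have hl : l = 0 := by
      simpa only [map_add, hfg.apply_apply_eq_zero, hσ l, zero_add, map_zero] using congrArg g hx
    have hk : k = 0 := by
      rwa [hl, map_zero, add_zero, map_eq_zero_iff f hf] at hx
    rw [hk, hl, SemiDirectSum.zero_eq_mk]
  · obtain ⟨k, hk⟩ := (hfg (x - σ (g x))).mp (by rw [map_sub, hσ, sub_self])
    exact ⟨⟨k, g x⟩, by simp only [semiDirectSumLift, LieHom.coe_mk, hk, sub_add_cancel]⟩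

/-- A split extension `K → M → L` of Lie algebras is the semidirect sum for the action of `L` on
`K` through the splitting `σ`. -/
def splitExtensionEquiv (hf : Function.Injective f) (hfg : Function.Exact f g)
    (hσ : Function.LeftInverse g σ) (hact : ∀ l k, ⁅σ l, f k⁆ = f (ψ l k)) :
    M ≃ₗ⁅R⁆ (K ⋊⁅ψ⁆ L) :=
  (LieEquiv.ofBijective (semiDirectSumLift f σ hact)
    (semiDirectSumLift_bijective hf hfg hσ hact)).symm

lemma splitExtensionEquiv_apply_inclusion (hf : Function.Injective f) (hfg : Function.Exact f g)
    (hσ : Function.LeftInverse g σ) (hact : ∀ l k, ⁅σ l, f k⁆ = f (ψ l k)) (k : K) :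
    splitExtensionEquiv hf hfg hσ hact (f k) = SemiDirectSum.inl ψ k := by
  rw [← semiDirectSumLift_inl hact k]
  exact LieEquiv.symm_apply_apply _ _

lemma splitExtensionEquiv_apply_section (hf : Function.Injective f) (hfg : Function.Exact f g)
    (hσ : Function.LeftInverse g σ) (hact : ∀ l k, ⁅σ l, f k⁆ = f (ψ l k)) (l : L) :
    splitExtensionEquiv hf hfg hσ hact (σ l) = SemiDirectSum.inr ψ l := by
  rw [← semiDirectSumLift_inr hact l]
  exact LieEquiv.symm_apply_apply _ _

end SplitExtension

instance {M : Type*} [AddCommGroup M] : IsLieAbelian (AbelianLie M) where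
  trivial _ _ := rfl

section QuadraticMap

variable {R : Type*} [CommRing R] {M : Type*} [AddCommGroup M] [Module R M]
variable {M' : Type*} [AddCommGroup M'] [Module R M'] {N : Type*} [AddCommGroup N] [Module R N]
variable {Q : QuadraticMap R M N} {Q' : QuadraticMap R M' N} {e : M}
variable {r : Q →qᵢ Q'} {s : Q' →qᵢ Q}

lemma isOrtho_of_mem_radical (he : e ∈ Q.radical) (v : M) : Q.IsOrtho v e := by
  obtain ⟨h₀, hadd⟩ := QuadraticMap.mem_radical_iff'.mp he
  rw [QuadraticMap.isOrtho_comm, QuadraticMap.isOrtho_def, hadd, h₀, zero_add]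

lemma mem_radical_of_map_eq_zero (he : r e = 0) : e ∈ Q.radical := by
  refine QuadraticMap.mem_radical_iff'.mpr ⟨?_, fun v => ?_⟩
  · rw [← r.map_app, he, QuadraticMap.map_zero]
  · rw [← r.map_app, map_add, he, zero_add, r.map_app]

lemma map_eq_zero_of_ker_eq_span (hr : LinearMap.ker r.toLinearMap = Submodule.span R {e}) :
    r e = 0 :=
  LinearMap.mem_ker.mp (hr.ge (Submodule.mem_span_singleton_self e))

lemma mem_radical_of_ker_eq_span (hr : LinearMap.ker r.toLinearMap = Submodule.span R {e}) :
    e ∈ Q.radical :=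
  mem_radical_of_map_eq_zero (map_eq_zero_of_ker_eq_span hr)

lemma exists_smul_eq_sub_map_map (hrs : Function.LeftInverse r s)
    (hr : LinearMap.ker r.toLinearMap = Submodule.span R {e}) (v : M) :
    ∃ c : R, c • e = v - s (r v) := by
  rw [← Submodule.mem_span_singleton, ← hr]
  change r (v - s (r v)) = 0
  rw [map_sub, hrs, sub_self]

end QuadraticMap

section Wedge

variable {F : Type*} [Field F] [Invertible (2 : F)] {V : Type*} [AddCommGroup V] [Module F V]

/-- The bivector `u × v`, which corresponds to `u ∧ v` in the exterior algebra. -/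
def wedge (Q : QuadraticForm F V) : V →ₗ[F] V →ₗ[F] Bivector Q :=
  LinearMap.mk₂ F (fun u v => ⟨comm (F := F) (ι Q u) (ι Q v), comm_ι_mem Q u v⟩)
    (fun u u' v => Subtype.ext <| by simp only [← commL_apply, map_add, LinearMap.add_apply,
      Submodule.coe_add])
    (fun c u v => Subtype.ext <| by simp only [← commL_apply, map_smul, LinearMap.smul_apply,
      Submodule.coe_smul])
    (fun u v v' => Subtype.ext <| by simp only [← commL_apply, map_add, Submodule.coe_add])
    (fun c u v => Subtype.ext <| by simp only [← commL_apply, map_smul, Submodule.coe_smul])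

variable {Q : QuadraticForm F V}

lemma coe_wedge (u v : V) : (wedge Q u v).1 = comm (F := F) (ι Q u) (ι Q v) := rfl

lemma wedge_self (v : V) : wedge Q v v = 0 := Subtype.ext (comm_self _)

lemma wedge_swap (u v : V) : wedge Q v u = -wedge Q u v := by
  apply Subtype.ext
  rw [Submodule.coe_neg, coe_wedge, coe_wedge, comm, comm, ← smul_neg, neg_sub]

lemma coe_wedge_of_isOrtho {u v : V} (h : Q.IsOrtho u v) :
    (wedge Q u v).1 = ι Q u * ι Q v := by
  rw [coe_wedge, comm, ι_mul_ι_comm_of_isOrtho h.symm, sub_neg_eq_add, smul_add,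
    invOf_two_smul_add_invOf_two_smul]

lemma mem_of_forall_wedge_mem {p : Submodule F (Bivector Q)} (h : ∀ u v, wedge Q u v ∈ p)
    (b : Bivector Q) : b ∈ p := by
  have hle : grade Q 2 ≤ p.map (grade Q 2).subtype := by
    conv_lhs => rw [grade_two_eq_span]
    rw [Submodule.span_le]
    rintro _ ⟨u, v, rfl⟩
    exact Submodule.mem_map_of_mem (h u v)
  obtain ⟨c, hc, hcb⟩ := hle b.2
  rwa [← Subtype.ext hcb]

lemma ι_injective (Q : QuadraticForm F V) : Function.Injective (ι Q) :=
  Function.LeftInverse.injective (vectorPart_ι Q)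

lemma actVec_wedge (u v w : V) :
    actVec Q (wedge Q u v) w =
      (⅟2 * QuadraticMap.polar Q v w) • u - (⅟2 * QuadraticMap.polar Q u w) • v :=
  ι_injective Q <| by rw [ι_actVec, coe_wedge, comm_comm_ι]

lemma lie_wedge (b : Bivector Q) (u v : V) :
    ⁅b, wedge Q u v⁆ = wedge Q (actVec Q b u) v + wedge Q u (actVec Q b v) := by
  apply Subtype.ext
  rw [coe_lie, Submodule.coe_add, coe_wedge, coe_wedge, coe_wedge, ι_actVec, ι_actVec,
    comm_leibniz]

lemma contractLeft_wedge (d : Module.Dual F V) (u v : V) :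
    contractLeft d (wedge Q u v).1 = ι Q (d u • v - d v • u) := by
  have h (u v : V) : contractLeft d (ι Q u * ι Q v) = ι Q (d u • v - d v • u) := by
    rw [contractLeft_ι_mul, contractLeft_ι, ← Algebra.commutes, ← Algebra.smul_def, map_sub,
      map_smul, map_smul]
  rw [coe_wedge, comm, map_smul, map_sub, h, h, ← map_sub, ← map_smul, ← neg_sub (d u • v),
    sub_neg_eq_add, smul_add, invOf_two_smul_add_invOf_two_smul]

lemma ker_wedge_flip {e : V} (he₀ : e ≠ 0) :
    LinearMap.ker ((wedge Q).flip e) = Submodule.span F {e} := by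
  apply le_antisymm
  · intro v (hv : wedge Q v e = 0)
    obtain ⟨d, hd⟩ := Module.Projective.exists_dual_eq_one F he₀
    have h : ι Q (d v • e - d e • v) = 0 := by
      rw [← contractLeft_wedge, hv, Submodule.coe_zero, map_zero]
    rw [map_eq_zero_iff _ (ι_injective Q), hd, one_smul, sub_eq_zero] at h
    exact Submodule.mem_span_singleton.mpr ⟨d v, h⟩
  · rw [Submodule.span_singleton_le_iff_mem]
    exact wedge_self e

end Wedge

section Radical

variable {F : Type*} [Field F] [Invertible (2 : F)] {V : Type*} [AddCommGroup V] [Module F V]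
variable {U : Type*} [AddCommGroup U] [Module F U] {Q : QuadraticForm F V} {e : V}

lemma actVec_eq_zero_of_mem_radical (he : e ∈ Q.radical) (b : Bivector Q) :
    actVec Q b e = 0 := by
  let action : Bivector Q →ₗ[F] V :=
    vectorPart Q ∘ₗ (commL (F := F) _).flip (ι Q e) ∘ₗ (grade Q 2).subtype
  refine mem_of_forall_wedge_mem (p := LinearMap.ker action) (fun u v => ?_) b
  change actVec Q (wedge Q u v) e = 0
  rw [actVec_wedge, (isOrtho_of_mem_radical he v).polar_eq_zero,
    (isOrtho_of_mem_radical he u).polar_eq_zero, mul_zero, zero_smul, zero_smul, sub_zero]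

lemma lie_wedge_of_mem_radical (he : e ∈ Q.radical) (b : Bivector Q) (v : V) :
    ⁅b, wedge Q v e⁆ = wedge Q (actVec Q b v) e := by
  rw [lie_wedge, actVec_eq_zero_of_mem_radical he, map_zero, add_zero]

lemma wedge_lie_wedge_of_mem_radical (he : e ∈ Q.radical) (u v : V) :
    ⁅wedge Q u e, wedge Q v e⁆ = 0 := by
  have hact : actVec Q (wedge Q u e) v = -(⅟2 * QuadraticMap.polar Q u v) • e := by
    rw [actVec_wedge, (isOrtho_of_mem_radical he v).symm.polar_eq_zero, mul_zero, zero_smul,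
      zero_sub, neg_smul]
  rw [lie_wedge_of_mem_radical he, hact, map_smul, LinearMap.smul_apply, wedge_self, smul_zero]

/-- The map `u ↦ s(u) e` into the bivectors, for `e` in the radical, as a homomorphism of Lie
algebras; it is encoded by `s(u) × e`, which equals `s(u) e`. -/
def wedgeRadicalHom (he : e ∈ Q.radical) (s : U →ₗ[F] V) : AbelianLie U →ₗ⁅F⁆ Bivector Q where
  toLinearMap := (wedge Q).flip e ∘ₗ s ∘ₗ (AbelianLie.of F).symm.toLinearMap
  map_lie' := by
    intro x y
    exact (map_zero ((wedge Q).flip e ∘ₗ s ∘ₗ (AbelianLie.of F).symm.toLinearMap)).trans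
      (wedge_lie_wedge_of_mem_radical he _ _).symm

lemma wedgeRadicalHom_of (he : e ∈ Q.radical) (s : U →ₗ[F] V) (u : U) :
    wedgeRadicalHom he s (AbelianLie.of F u) = wedge Q (s u) e := rfl

end Radical

section Isometry

variable {F : Type*} [Field F] [Invertible (2 : F)] {V : Type*} [AddCommGroup V] [Module F V]
variable {U : Type*} [AddCommGroup U] [Module F U] {U' : Type*} [AddCommGroup U'] [Module F U']
variable {Q : QuadraticForm F V} {Q' : QuadraticForm F U} {Q'' : QuadraticForm F U'}

lemma bivectorMap_wedge (f : Q →qᵢ Q') (u v : V) :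
    bivectorMap f (wedge Q u v) = wedge Q' (f u) (f v) := by
  apply Subtype.ext
  change CliffordAlgebra.map f (comm (F := F) (ι Q u) (ι Q v)) = _
  rw [map_comm, map_apply_ι, map_apply_ι, coe_wedge]

lemma actVec_bivectorMap (f : Q →qᵢ Q') (b : Bivector Q) (v : V) :
    actVec Q' (bivectorMap f b) (f v) = f (actVec Q b v) := by
  apply ι_injective Q'
  rw [ι_actVec, ← map_apply_ι, ← map_apply_ι, ι_actVec, map_comm]
  rfl

lemma bivectorMap_bivectorMap (f : Q' →qᵢ Q'') (g : Q →qᵢ Q') (b : Bivector Q) :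
    bivectorMap f (bivectorMap g b) = bivectorMap (f.comp g) b :=
  Subtype.ext (DFunLike.congr_fun (map_comp_map f g) b.1)

lemma bivectorMap_leftInverse {s : Q' →qᵢ Q} {r : Q →qᵢ Q'} (h : Function.LeftInverse r s) :
    Function.LeftInverse (bivectorMap r) (bivectorMap s) :=
  fun b => Subtype.ext (leftInverse_map_of_leftInverse s r h b.1)

end Isometry

section RadicalLine

variable {F : Type*} [Field F] [Invertible (2 : F)] {V : Type*} [AddCommGroup V] [Module F V]
variable {U : Type*} [AddCommGroup U] [Module F U] {Q : QuadraticForm F V} {Q' : QuadraticForm F U}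
variable {e : V} {s : Q' →qᵢ Q} {r : Q →qᵢ Q'}

lemma wedge_map_map_eq (hrs : Function.LeftInverse r s)
    (hr : LinearMap.ker r.toLinearMap = Submodule.span F {e}) (v : V) :
    wedge Q (s (r v)) e = wedge Q v e := by
  obtain ⟨c, hc⟩ := exists_smul_eq_sub_map_map hrs hr v
  have h : wedge Q (v - s (r v)) e = 0 := by
    rw [← hc, map_smul, LinearMap.smul_apply, wedge_self, smul_zero]
  rw [map_sub, LinearMap.sub_apply, sub_eq_zero] at h
  exact h.symm

lemma wedgeRadicalHom_injective (he₀ : e ≠ 0) (hrs : Function.LeftInverse r s)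
    (hr : LinearMap.ker r.toLinearMap = Submodule.span F {e}) :
    Function.Injective (wedgeRadicalHom (mem_radical_of_ker_eq_span hr) s.toLinearMap) := by
  refine (injective_iff_map_eq_zero _).mpr fun u hu => ?_
  have hsu : s u ∈ LinearMap.ker r.toLinearMap := by
    rw [hr, ← ker_wedge_flip (Q := Q) he₀]
    exact hu
  exact (hrs u).symm.trans hsu

lemma sub_bivectorMap_bivectorMap_mem_range (hrs : Function.LeftInverse r s)
    (hr : LinearMap.ker r.toLinearMap = Submodule.span F {e}) (x : Bivector Q) :
    x - bivectorMap s (bivectorMap r x) ∈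
      LinearMap.range ((wedge Q).flip e ∘ₗ s.toLinearMap) := by
  let residual : Bivector Q →ₗ[F] Bivector Q :=
    LinearMap.id - (bivectorMap s).toLinearMap ∘ₗ (bivectorMap r).toLinearMap
  refine mem_of_forall_wedge_mem (p := Submodule.comap residual
    (LinearMap.range ((wedge Q).flip e ∘ₗ s.toLinearMap))) (fun v w => ?_) x
  obtain ⟨c, hc⟩ := exists_smul_eq_sub_map_map hrs hr v
  obtain ⟨d, hd⟩ := exists_smul_eq_sub_map_map hrs hr w
  refine ⟨d • r v - c • r w, ?_⟩
  change wedge Q (s (d • r v - c • r w)) e =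
    wedge Q v w - bivectorMap s (bivectorMap r (wedge Q v w))
  calc wedge Q (s (d • r v - c • r w)) e
      = wedge Q (c • e) w + wedge Q (s (r v)) (d • e) := by
        simp only [map_sub, map_smul, LinearMap.sub_apply, LinearMap.smul_apply,
          wedge_map_map_eq hrs hr, wedge_swap w e, smul_neg]
        abel
    _ = wedge Q v w - bivectorMap s (bivectorMap r (wedge Q v w)) := by
        rw [hc, hd, bivectorMap_wedge, bivectorMap_wedge, map_sub, map_sub, LinearMap.sub_apply,
          sub_add_sub_cancel]

lemma exact_wedgeRadicalHom_bivectorMap (hrs : Function.LeftInverse r s)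
    (hr : LinearMap.ker r.toLinearMap = Submodule.span F {e}) :
    Function.Exact (wedgeRadicalHom (mem_radical_of_ker_eq_span hr) s.toLinearMap)
      (bivectorMap r) := by
  refine fun x => ⟨fun hx => ?_, ?_⟩
  · have h := sub_bivectorMap_bivectorMap_mem_range hrs hr x
    rwa [hx, map_zero, sub_zero] at h
  · rintro ⟨u, rfl⟩
    change bivectorMap r (wedge Q (s u) e) = 0
    rw [bivectorMap_wedge, map_eq_zero_of_ker_eq_span hr, map_zero]

lemma bivectorMap_lie_wedgeRadicalHom (he : e ∈ Q.radical) (b : Bivector Q') (u : AbelianLie U) :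
    ⁅bivectorMap s b, wedgeRadicalHom he s.toLinearMap u⁆ =
      wedgeRadicalHom he s.toLinearMap (tau Q' b u) := by
  obtain ⟨u, rfl⟩ := (AbelianLie.of F).surjective u
  rw [tau_apply, wedgeRadicalHom_of, wedgeRadicalHom_of, lie_wedge_of_mem_radical he]
  exact congrArg (wedge Q · e) (actVec_bivectorMap s b u)

lemma val_image_ker_bivectorMap (hrs : Function.LeftInverse r s)
    (hr : LinearMap.ker r.toLinearMap = Submodule.span F {e}) :
    Subtype.val '' ((bivectorMap r).ker : Set (Bivector Q)) =
      {x | ∃ u, x = ι Q (s u) * ι Q e} := by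
  have coe_wedge_map (u : U) : (wedge Q (s u) e).1 = ι Q (s u) * ι Q e :=
    coe_wedge_of_isOrtho (isOrtho_of_mem_radical (mem_radical_of_ker_eq_span hr) _)
  have hexact := exact_wedgeRadicalHom_bivectorMap hrs hr
  ext x
  constructor
  · rintro ⟨y, hy, rfl⟩
    obtain ⟨u, rfl⟩ := (hexact y).mp hy
    exact ⟨u, coe_wedge_map u⟩
  · rintro ⟨u, rfl⟩
    exact ⟨wedge Q (s u) e, (hexact _).mpr ⟨u, rfl⟩, coe_wedge_map u⟩

/-- The isomorphism `Cl²(V) ≅ Cl²(U) ⋉_τ U` given by an isometric retraction `r : V → U` with kernel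
`F e` and an isometric section `s` of it. -/
def bivectorSplitEquiv (he₀ : e ≠ 0) (hrs : Function.LeftInverse r s)
    (hr : LinearMap.ker r.toLinearMap = Submodule.span F {e}) :
    Bivector Q ≃ₗ⁅F⁆ (AbelianLie U ⋊⁅tau Q'⁆ Bivector Q') :=
  splitExtensionEquiv (wedgeRadicalHom_injective he₀ hrs hr)
    (exact_wedgeRadicalHom_bivectorMap hrs hr) (bivectorMap_leftInverse hrs)
    (bivectorMap_lie_wedgeRadicalHom (mem_radical_of_ker_eq_span hr))

lemma bivectorSplitEquiv_bivectorMap (he₀ : e ≠ 0) (hrs : Function.LeftInverse r s)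
    (hr : LinearMap.ker r.toLinearMap = Submodule.span F {e}) (b : Bivector Q') :
    bivectorSplitEquiv he₀ hrs hr (bivectorMap s b) = SemiDirectSum.inr _ b :=
  splitExtensionEquiv_apply_section _ _ _ _ b

lemma bivectorSplitEquiv_of_coe_eq_ι_mul_ι (he₀ : e ≠ 0) (hrs : Function.LeftInverse r s)
    (hr : LinearMap.ker r.toLinearMap = Submodule.span F {e}) {x : Bivector Q} {v : V}
    (hx : x.1 = ι Q v * ι Q e) :
    bivectorSplitEquiv he₀ hrs hr x = SemiDirectSum.inl _ (AbelianLie.of F (r v)) := by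
  have he := mem_radical_of_ker_eq_span hr
  have hxw : x = wedgeRadicalHom he s.toLinearMap (AbelianLie.of F (r v)) :=
    calc x = wedge Q v e :=
          Subtype.ext (hx.trans (coe_wedge_of_isOrtho (isOrtho_of_mem_radical he v)).symm)
      _ = wedge Q (s (r v)) e := (wedge_map_map_eq hrs hr v).symm
  rw [hxw]
  exact splitExtensionEquiv_apply_inclusion _ _ _ _ _

end RadicalLine

section Complement

variable {F : Type*} [Field F] {V : Type*} [AddCommGroup V] [Module F V]
variable (B : LinearMap.BilinForm F V) (hB : B.IsSymm) (U : Submodule F V)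
variable (hU : U ≤ LinearMap.ker B) (W : Submodule F V) (hW : IsCompl W U)

/-- The isometry from a complement `W` of a radical subspace `U` onto `V ⧸ U`. -/
def complementIsometryEquiv :
    (quad (B.restrict W)).IsometryEquiv (quad (quotientForm B hB U hU)) where
  toLinearEquiv := (U.quotientEquivOfIsCompl W hW.symm).symm
  map_app' _ := rfl

/-- The isometric projection of `V` onto a complement of a radical subspace. -/
def complementRetraction : quad B →qᵢ quad (B.restrict W) :=
  (complementIsometryEquiv B hB U hU W hW).symm.toIsometry.comp (projection B hB U hU)

/-- The isometric section of `V → V ⧸ U` with image a complement of the radical subspace `U`. -/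
def quotientSection : quad (quotientForm B hB U hU) →qᵢ quad B :=
  (inclusion B W).comp (complementIsometryEquiv B hB U hU W hW).symm.toIsometry

lemma complementRetraction_leftInverse_inclusion :
    Function.LeftInverse (complementRetraction B hB U hU W hW) (inclusion B W) :=
  (complementIsometryEquiv B hB U hU W hW).symm_apply_apply

lemma projection_leftInverse_quotientSection :
    Function.LeftInverse (projection B hB U hU) (quotientSection B hB U hU W hW) :=
  (complementIsometryEquiv B hB U hU W hW).apply_symm_apply

lemma ker_projection : LinearMap.ker (projection B hB U hU).toLinearMap = U :=
  U.ker_mkQ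

lemma ker_complementRetraction :
    LinearMap.ker (complementRetraction B hB U hU W hW).toLinearMap = U :=
  (LinearEquiv.ker_comp _ _).trans U.ker_mkQ

lemma quotientSection_comp_projection_comp_inclusion :
    ((quotientSection B hB U hU W hW).comp (projection B hB U hU)).comp (inclusion B W) =
      inclusion B W :=
  QuadraticMap.Isometry.ext fun w =>
    congrArg Subtype.val (complementRetraction_leftInverse_inclusion B hB U hU W hW w)

end Complement

end PGA

end

open CliffordAlgebra LieAlgebra in
theorem mainTheorem4 {F : Type*} [Field F] [Invertible (2 : F)]
    {V : Type*} [AddCommGroup V] [Module F V]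
    (B : LinearMap.BilinForm F V) (hB : B.IsSymm)
    (e₀ : V) (he₀ : e₀ ≠ 0) (hrad : Submodule.span F {e₀} ≤ LinearMap.ker B)
    (W : Submodule F V) (hW : IsCompl W (Submodule.span F {e₀})) :
    -- `Cl²(V)` is the internal semidirect sum of the subalgebra `Cl²(W)` and the
    -- abelian ideal `W e₀`
    (Function.Injective (PGA.bivectorMap (PGA.inclusion B W)) ∧
      ∃ I : LieIdeal F (PGA.Bivector (PGA.quad B)),
        Subtype.val '' (I : Set (PGA.Bivector (PGA.quad B))) =
          {x | ∃ w ∈ W, x = ι (PGA.quad B) w * ι (PGA.quad B) e₀} ∧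
        IsLieAbelian I ∧
        IsCompl (PGA.bivectorMap (PGA.inclusion B W)).range.toSubmodule I.toSubmodule) ∧
    -- `Cl²(V) ≅ Cl²(W) ⋉_τ W`
    (∃ φ : PGA.Bivector (PGA.quad B) ≃ₗ⁅F⁆
        (PGA.AbelianLie W ⋊⁅PGA.tau (PGA.quad (B.restrict W))⁆
          PGA.Bivector (PGA.quad (B.restrict W))),
      (∀ b, φ (PGA.bivectorMap (PGA.inclusion B W) b) = SemiDirectSum.inr _ b) ∧
      ∀ (w : W) (x : PGA.Bivector (PGA.quad B)),
        x.1 = ι (PGA.quad B) (w : V) * ι (PGA.quad B) e₀ →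
          φ x = SemiDirectSum.inl _ (PGA.AbelianLie.of F w)) ∧
    -- `Cl²(V) ≅ Cl²(V/Fe₀) ⋉_τ' V/Fe₀`
    (∃ φ' : PGA.Bivector (PGA.quad B) ≃ₗ⁅F⁆
        (PGA.AbelianLie (V ⧸ Submodule.span F {e₀})
          ⋊⁅PGA.tau (PGA.quad (PGA.quotientForm B hB (Submodule.span F {e₀}) hrad))⁆
          PGA.Bivector (PGA.quad (PGA.quotientForm B hB (Submodule.span F {e₀}) hrad))),
      (∀ b, φ' (PGA.bivectorMap (PGA.inclusion B W) b) = SemiDirectSum.inr _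
        (PGA.bivectorMap (PGA.projection B hB (Submodule.span F {e₀}) hrad)
          (PGA.bivectorMap (PGA.inclusion B W) b))) ∧
      ∀ (w : W) (x : PGA.Bivector (PGA.quad B)),
        x.1 = ι (PGA.quad B) (w : V) * ι (PGA.quad B) e₀ →
          φ' x = SemiDirectSum.inl _
            (PGA.AbelianLie.of F (Submodule.Quotient.mk (w : V)))) := by
  have hrs := PGA.complementRetraction_leftInverse_inclusion B hB _ hrad W hW
  have hr := PGA.ker_complementRetraction B hB _ hrad W hW
  have hps := PGA.projection_leftInverse_quotientSection B hB _ hrad W hW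
  have hp := PGA.ker_projection B hB _ hrad
  refine ⟨⟨(PGA.bivectorMap_leftInverse hrs).injective,
      (PGA.bivectorMap (PGA.complementRetraction B hB _ hrad W hW)).ker, ?_,
      PGA.isLieAbelian_ker_of_exact (PGA.exact_wedgeRadicalHom_bivectorMap hrs hr),
      PGA.isCompl_range_ker_of_leftInverse (PGA.bivectorMap_leftInverse hrs)⟩,
    ⟨PGA.bivectorSplitEquiv he₀ hrs hr, PGA.bivectorSplitEquiv_bivectorMap he₀ hrs hr, ?_⟩,
    ⟨PGA.bivectorSplitEquiv he₀ hps hp, ?_, ?_⟩⟩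
  · rw [PGA.val_image_ker_bivectorMap hrs hr]
    exact Set.ext fun x => ⟨fun ⟨w, hw⟩ => ⟨w, w.2, hw⟩, fun ⟨w, hwW, hw⟩ => ⟨⟨w, hwW⟩, hw⟩⟩
  · intro w x hx
    rw [PGA.bivectorSplitEquiv_of_coe_eq_ι_mul_ι he₀ hrs hr hx]
    exact congrArg (fun u => SemiDirectSum.inl _ (PGA.AbelianLie.of F u)) (hrs w)
  · intro b
    rw [← PGA.bivectorSplitEquiv_bivectorMap he₀ hps hp, PGA.bivectorMap_bivectorMap,
      PGA.bivectorMap_bivectorMap, PGA.quotientSection_comp_projection_comp_inclusion]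
  · intro w x hx
    exact PGA.bivectorSplitEquiv_of_coe_eq_ι_mul_ι he₀ hps hp hx
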